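/- **Definitions.** Let $\Sigma$ be a (possibly infinite) set with the discrete topology and $d<\omega$. A $d$-dimensional *subshift* on the alphabet $\Sigma$ is a subset of $\Sigma^{\mathbb Z^d}$ that is closed in the product topology and invariant under the shifts $x\mapsto x(\cdot+v)$, $v\in\mathbb Z^d$. A ($d$-dimensional) *word* on $\Sigma$ is a map $w:D\to\Sigma$ from a rectangle $D=[m_0,n_0]\times\dots\times[m_{d-1},n_{d-1}]\subseteq\mathbb Z^d$ with all $m_i\le n_i$; $\Sigma^{*d}$ is the set of these words. For $d\le e$ we identify $\mathbb Z^d$ with $\mathbb Z^d\times\{0\}^{e-d}\subseteq\mathbb Z^e$, and so $\Sigma^{*d}$ with a subset of $\Sigma^{*e}$. For a $d$-dimensional subshift $S$, the *co-language* $\mathcal L^c(S)$ is the set of words $w\in\Sigma^{*d}$ with $x\restriction_{\operatorname{dom}(w)}\ne w$ for all $x\in S$, and the *language* is $\mathcal L(S)=\Sigma^{*d}\setminus\mathcal L^c(S)$. Let $S$, $T$ be subshifts on the alphabets $\Sigma_S$, $\Sigma_T$ in dimensions $d_S$, $d_T$. We write $S\sqsubseteq T$ if $\Sigma_S\subseteq\Sigma_T$,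 $d_S\le d_T$ and $\mathcal L(T)\cap\Sigma_S^{*d_S}=\mathcal L(S)$. We write $S\mathrel{\sqsubseteq_\sim}T$ if there is an injective map $\hat f:\Sigma_S\to\Sigma_T$ such that $f(S)\sqsubseteq T$, where $f(S)=\{\hat f\circ x\mid x\in S\}$ is a subshift on the alphabet $\hat f(\Sigma_S)$. Let $M$ be a $d$-dimensional subshift on $\Sigma$, let $X$ be a countably infinite set of variables, disjoint from $\Sigma$, and let $U,V$ be finite sets of words in $(\Sigma\cup X)^{*d}$. The pair $(U,V)$ is *satisfied* in a subshift $S$ with $\Sigma_S\supseteq\Sigma$ and $d_S\ge d$ if there is an assignment $X\to\Sigma_S$ of letters to the variables (not necessarily injective) such that, after substitution, all words of $U$ are in $\mathcal L(S)$ and all words of $V$ are in $\mathcal L^c(S)$. The pair is *consistent with* $M$ if it is satisfied in some subshift $S$ with $M\sqsubseteq S$ (on any alphabet $\Sigma_S\supseteq\Sigma$ and in any dimension $d_S\ge d$). The subshift $M$ is *existentially closed for consistent systems (ecfcs)* if every such pair $(U,V)$ of finite sets that is consistent with $M$ is satisfied in $M$. **Proposition.** Let $d\ge 1$ and let $\Sigma$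 be a countably infinite alphabet. There is a family $(M_\alpha)_{\alpha\in\{0,1\}^{\mathbb N}}$ of $d$-dimensional ecfcs subshifts on the alphabet $\Sigma$ such that $M_\alpha\not\mathrel{\sqsubseteq_\sim}M_\beta$ whenever $\alpha\ne\beta$. (In particular there are $2^{\aleph_0}$ of them.) -/

import Mathlib

universe u

/-- A `d`-dimensional subshift on the alphabet `A`: a shift-invariant subset of `A^(ℤ^d)`, closed
in the product topology, where the (possibly infinite) alphabet `A` is discrete. -/
abbrev ZSubshift (A : Type u) (d : ℕ) : Type u :=
  @SymbolicDynamics.FullShift.Subshift A ⊥ (Fin d → ℤ) _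

/-- A `d`-dimensional word on the alphabet `A`: a map to `A` from a (nonempty) rectangle
`[lo 0, hi 0] × ⋯ × [lo (d-1), hi (d-1)]` of `ℤ^d`. -/
structure ZWord (A : Type u) (d : ℕ) where
  lo : Fin d → ℤ
  hi : Fin d → ℤ
  le : lo ≤ hi
  letter : Set.Icc lo hi → A

/-- The embedding `ℤ^d → ℤ^e`, `v ↦ (v, 0, …, 0)`, for `d ≤ e`. -/
def zeroExtend {d e : ℕ} (v : Fin d → ℤ) : Fin e → ℤ :=
  fun i => if h : i.val < d then v ⟨i.val, h⟩ else 0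

theorem restrict_mem_Icc {d e : ℕ} (hde : d ≤ e) {lo hi : Fin d → ℤ} {p : Fin e → ℤ}
    (hp : p ∈ Set.Icc (zeroExtend lo) (zeroExtend hi)) :
    (fun i => p (Fin.castLE hde i)) ∈ Set.Icc lo hi := by
  constructor
  · intro i
    have h := hp.1 (Fin.castLE hde i)
    simpa [zeroExtend] using h
  · intro i
    have h := hp.2 (Fin.castLE hde i)
    simpa [zeroExtend] using h

/-- Replace every letter `a` of the word `w` by `f a`, and regard the result, whose domain is a
rectangle `D ⊆ ℤ^d`, as an `e`-dimensional word with domain `D × {0}`, for `d ≤ e`. -/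
def ZWord.transport {A B : Type u} {d e : ℕ} (hde : d ≤ e) (f : A → B) (w : ZWord A d) :
    ZWord B e where
  lo := zeroExtend w.lo
  hi := zeroExtend w.hi
  le := by
    intro i
    unfold zeroExtend
    split
    · exact w.le _
    · exact le_rfl
  letter p := f (w.letter ⟨fun i => p.1 (Fin.castLE hde i), restrict_mem_Icc hde p.2⟩)

/-- The set of points (configurations) of `S`. -/
def points {A : Type u} {d : ℕ} (S : ZSubshift A d) : Set ((Fin d → ℤ) → A) :=
  @SymbolicDynamics.FullShift.Subshift.carrier A ⊥ (Fin d → ℤ) _ S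

/-- The co-language of `S`: the words `w` with `x ↾ dom w ≠ w` for all `x ∈ S`. -/
def coLanguage {A : Type u} {d : ℕ} (S : ZSubshift A d) : Set (ZWord A d) :=
  {w | ∀ x ∈ points S, (Set.Icc w.lo w.hi).domRestrict x ≠ w.letter}

/-- The language of `S`: the complement of the co-language. -/
def language {A : Type u} {d : ℕ} (S : ZSubshift A d) : Set (ZWord A d) :=
  (coLanguage S)ᶜ

/-- `f(S) ⊑ T`, for a map `f : A → B` of the alphabets (only used for injective `f`) and `d ≤ e`:
the words in the language of `T` that are `d`-dimensional words on the alphabet `f(A)` are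
exactly the words in the language of `f(S)`.  If `f` is an inclusion of alphabets, this says
that `S` is a full restriction of `T`. -/
def IsFullRestrictionVia {A B : Type u} {d e : ℕ} (hde : d ≤ e) (f : A → B)
    (S : ZSubshift A d) (T : ZSubshift B e) : Prop :=
  language T ∩ Set.range (ZWord.transport (A := A) hde f) = ZWord.transport hde f '' language S

/-- `S ⊑∼ T`: there is an injection `f` of the alphabets with `f(S) ⊑ T`. -/
def Embeds {A B : Type u} {d e : ℕ} (S : ZSubshift A d) (T : ZSubshift B e) : Prop :=
  ∃ (hde : d ≤ e) (f : A → B), Function.Injective f ∧ IsFullRestrictionVia hde f S T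

/-- `L(U(x, a)) ∧ L^c(V(x, a))` is satisfied in `S`.  The letters of the words in `U` and `V` are
constants from `A`, interpreted in the alphabet `B` of `S` through `ι`, and variables (the
elements of `ℕ`), which are interpreted by some letters `b n` of `B`. -/
def IsSatisfied {A B : Type u} {d e : ℕ} (hde : d ≤ e) (ι : A → B) (U V : Set (ZWord (A ⊕ ℕ) d))
    (S : ZSubshift B e) : Prop :=
  ∃ b : ℕ → B, (∀ w ∈ U, w.transport hde (Sum.elim ι b) ∈ language S) ∧
    ∀ w ∈ V, w.transport hde (Sum.elim ι b) ∈ coLanguage S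

/-- `∃ x (L(U(x, a)) ∧ L^c(V(x, a)))` is consistent with `T`: it is satisfied in some subshift
`S`, of any dimension `e ≥ d` and on any alphabet `B` extending `A`, of which `T` is a full
restriction. -/
def IsConsistentWith {A : Type u} {d : ℕ} (U V : Set (ZWord (A ⊕ ℕ) d)) (T : ZSubshift A d) :
    Prop :=
  ∃ (B : Type u) (ι : A → B) (e : ℕ) (hde : d ≤ e) (S : ZSubshift B e),
    Function.Injective ι ∧ IsFullRestrictionVia hde ι T S ∧ IsSatisfied hde ι U V S

/-- `M` is existentially closed for consistent systems (ecfcs) in its dimension `d`. -/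
def IsEcfcs {A : Type u} {d : ℕ} (M : ZSubshift A d) : Prop :=
  ∀ U V : Set (ZWord (A ⊕ ℕ) d), U.Finite → V.Finite →
    IsConsistentWith U V M → IsSatisfied le_rfl id U V M

/-! The subshifts are built by forcing with finite conditions. A `Cond` consists of finitely many
almost constant points and finitely many forbidden words; a chain of conditions yields the subshift
generated by all its points. Two kinds of requirements are dense, and there are countably many of
each.

Existential closure: if a finite system does not already clash with the condition and cannot be made
to clash by adding a reserved point, then assigning fresh letters to the variables, padding the
words of `U` with another fresh letter and forbidding the words of `V` makes it true
(`Cond.exists_decides`). A clash refutes consistency (`Blocked.not_isConsistentWith`).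

Non-embedding: for letters `a ≠ b`, the point with exactly two letters `a`, separated by `i` letters
`b`, goes into one condition, while the image of its word `a b ⋯ b a` is forbidden in the other
(`Cond.exists_separates`). The field `sparse` leaves almost all of these reserved points available
at every stage. An embedding `f` matters only through `(f a, f b)`, so countably many requirements
defeat all injections. `exists_mutually_generic` meets everything along the branches of a binary
tree. -/

/-! ### Mutually generic families -/

/-- Finitely many conditions can be extended so as to meet given dense requirements on single
conditions and on pairs of conditions. -/
theorem exists_extension_of_finite {C ι : Type*} [Preorder C] [Finite ι] {D : Set C}
    {E : Set (C × C)} (hD : ∀ c, ∃ c' ≥ c, c' ∈ D)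
    (hE : ∀ c e, ∃ c' ≥ c, ∃ e' ≥ e, (c', e') ∈ E) (hE' : IsUpperSet E) (c : ι → C) :
    ∃ c' ≥ c, (∀ i, c' i ∈ D) ∧ ∀ i j, i ≠ j → (c' i, c' j) ∈ E := by
  classical
  have := Fintype.ofFinite ι
  have key : ∀ T : Finset (ι × ι), ∃ c' ≥ c, ∀ q ∈ T, q.1 ≠ q.2 → (c' q.1, c' q.2) ∈ E := by
    intro T
    induction T using Finset.induction_on with
    | empty => exact ⟨c, le_rfl, by simp⟩
    | insert q T _ ih =>
      obtain ⟨c', hc', h⟩ := ih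
      by_cases hq : q.1 = q.2
      · refine ⟨c', hc', fun r hr hne => ?_⟩
        rcases Finset.mem_insert.1 hr with rfl | hr
        · exact absurd hq hne
        · exact h r hr hne
      obtain ⟨x, hx, y, hy, hxy⟩ := hE (c' q.1) (c' q.2)
      have hle : c' ≤ Function.update (Function.update c' q.1 x) q.2 y := by
        intro i
        by_cases h2 : i = q.2
        · subst h2; simpa using hy
        by_cases h1 : i = q.1
        · subst h1; simpa [h2] using hx
        · simp [h1, h2]
      refine ⟨_, hc'.trans hle, fun r hr hne => ?_⟩
      rcases Finset.mem_insert.1 hr with rfl | hr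
      · simpa [hq] using hxy
      · exact hE' (Prod.mk_le_mk.2 ⟨hle _, hle _⟩) (h r hr hne)
  obtain ⟨c', hc', h⟩ := key Finset.univ
  -- `D` is met last: pairs already in `E` stay there because `E` is upward closed, whereas `D` need
  -- not be.
  choose g hg hgD using hD
  refine ⟨fun i => g (c' i), fun i => (hc' i).trans (hg _), fun i => hgD _, fun i j hij => ?_⟩
  exact hE' (Prod.mk_le_mk.2 ⟨hg _, hg _⟩) (h (i, j) (Finset.mem_univ _) hij)

/-- There is a family, indexed by the Cantor space, of chains of conditions that meet countably many
dense requirements, and that pairwise meet countably many dense requirements on pairs. -/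
theorem exists_mutually_generic {C : Type*} [Preorder C] [Nonempty C] (D : ℕ → Set C)
    (E : ℕ → Set (C × C)) (hD : ∀ k c, ∃ c' ≥ c, c' ∈ D k)
    (hE : ∀ k c e, ∃ c' ≥ c, ∃ e' ≥ e, (c', e') ∈ E k) (hE' : ∀ k, IsUpperSet (E k)) :
    ∃ s : (ℕ → Bool) → ℕ → C, (∀ α, Monotone (s α)) ∧ (∀ α k, ∃ n, s α n ∈ D k) ∧
      ∀ α β, α ≠ β → ∀ k, ∃ n, (s α n, s β n) ∈ E k := by
  -- Unpairing `n` treats each requirement at infinitely many levels, hence also after any two given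
  -- branches have split.
  have step : ∀ (n : ℕ) (c : (Fin n → Bool) → C), ∃ c' : (Fin (n + 1) → Bool) → C,
      (∀ τ, c (fun i => τ i.castSucc) ≤ c' τ) ∧ (∀ τ, c' τ ∈ D n.unpair.1) ∧
      ∀ τ τ', τ ≠ τ' → (c' τ, c' τ') ∈ E n.unpair.1 := fun n c =>
    exists_extension_of_finite (hD _) (hE _) (hE' _)
      fun (τ : Fin (n + 1) → Bool) => c fun i => τ i.castSucc
  choose next hle hnD hnE using step
  let G : (n : ℕ) → (Fin n → Bool) → C :=
    fun n => Nat.rec (fun _ => Classical.arbitrary C) (fun n c => next n c) n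
  refine ⟨fun α n => G n fun i => α i, fun α => monotone_nat_of_le_succ fun n => ?_,
    fun α k => ⟨Nat.pair k 0 + 1, ?_⟩, fun α β hαβ k => ?_⟩
  · exact hle n (G n) fun i => α i
  · have := hnD (Nat.pair k 0) (G _) fun i => α i
    rwa [Nat.unpair_pair] at this
  · obtain ⟨m, hm⟩ := Function.ne_iff.1 hαβ
    -- The branches differ at `m ≤ Nat.pair k m`, so their nodes at this level are distinct.
    refine ⟨Nat.pair k m + 1, ?_⟩
    have := hnE (Nat.pair k m) (G _) (fun i => α i) (fun i => β i) fun h => hm <|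
      congrFun h ⟨m, Nat.lt_succ_of_le (Nat.right_le_pair k m)⟩
    rwa [Nat.unpair_pair] at this

/-! ### Words and their occurrences -/

theorem zeroExtend_self {d : ℕ} (v : Fin d → ℤ) : zeroExtend v = v := by
  funext i; simp [zeroExtend]

theorem zeroExtend_castLE {d e : ℕ} (hde : d ≤ e) (v : Fin d → ℤ) (i : Fin d) :
    (zeroExtend v : Fin e → ℤ) (Fin.castLE hde i) = v i := by
  simp [zeroExtend]

theorem zeroExtend_mono {d e : ℕ} {v w : Fin d → ℤ} (h : v ≤ w) :
    (zeroExtend v : Fin e → ℤ) ≤ zeroExtend w := by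
  intro i
  unfold zeroExtend
  split
  · exact h _
  · exact le_rfl

theorem zeroExtend_add {d e : ℕ} (v w : Fin d → ℤ) :
    (zeroExtend (v + w) : Fin e → ℤ) = zeroExtend v + zeroExtend w := by
  funext i
  simp only [zeroExtend, Pi.add_apply]
  split <;> simp

theorem zeroExtend_restrict {d e : ℕ} (hde : d ≤ e) {lo hi : Fin d → ℤ} {p : Fin e → ℤ}
    (hp : p ∈ Set.Icc (zeroExtend lo) (zeroExtend hi)) :
    zeroExtend (fun i => p (Fin.castLE hde i)) = p := by
  funext i
  by_cases h : i.val < d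
  · simp [zeroExtend, h]
  · have h1 := hp.1 i
    have h2 := hp.2 i
    simp only [zeroExtend, h, dif_neg, not_false_eq_true] at h1 h2 ⊢
    exact le_antisymm h1 h2

theorem ZWord.transport_injective {A B : Type u} {d e : ℕ} (hde : d ≤ e) {f : A → B}
    (hf : Function.Injective f) : Function.Injective (ZWord.transport (A := A) hde f) := by
  have hz : ∀ v w : Fin d → ℤ, (zeroExtend v : Fin e → ℤ) = zeroExtend w → v = w := by
    intro v w h
    funext i
    rw [← zeroExtend_castLE hde v, h, zeroExtend_castLE]
  rintro ⟨lo, hi, hle, l⟩ ⟨lo', hi', hle', l'⟩ h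
  simp only [ZWord.transport, ZWord.mk.injEq] at h
  obtain ⟨h1, h2, h3⟩ := h
  obtain rfl := hz _ _ h1
  obtain rfl := hz _ _ h2
  congr 1
  funext p
  have := congrFun (eq_of_heq h3)
    ⟨zeroExtend p.1, zeroExtend_mono p.2.1, zeroExtend_mono p.2.2⟩
  simpa only [zeroExtend_castLE] using hf this

instance {A : Type u} [Countable A] {d : ℕ} : Countable (ZWord A d) := by
  have (lo hi : Fin d → ℤ) : Finite (Set.Icc lo hi) := (Set.finite_Icc lo hi).to_subtype
  let g : ZWord A d → (Σ q : (Fin d → ℤ) × (Fin d → ℤ), Set.Icc q.1 q.2 → A) :=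
    fun w => ⟨(w.lo, w.hi), w.letter⟩
  have hg : Function.Injective g := by
    rintro ⟨lo, hi, hle, l⟩ ⟨lo', hi', hle', l'⟩ h
    simp only [g, Sigma.mk.injEq, Prod.mk.injEq] at h
    obtain ⟨⟨rfl, rfl⟩, h⟩ := h
    rw [eq_of_heq h]
  exact hg.countable

/-- The letter of a word at a position, if the position lies in the domain. -/
noncomputable def ZWord.get {A : Type u} {d : ℕ} (w : ZWord A d) (p : Fin d → ℤ) : Option A :=
  open Classical in if h : p ∈ Set.Icc w.lo w.hi then some (w.letter ⟨p, h⟩) else none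

/-- After replacing each letter `a` by `f a`, some translate of `w` is a restriction of `x`. -/
def ZWord.OccursIn {A C : Type u} {d : ℕ} (f : A → C) (w : ZWord A d)
    (x : (Fin d → ℤ) → Option C) : Prop :=
  ∃ t, ∀ p (hp : p ∈ Set.Icc w.lo w.hi), x (p + t) = some (f (w.letter ⟨p, hp⟩))

theorem ZWord.get_eq_some_iff {A : Type u} {d : ℕ} {w : ZWord A d} {p : Fin d → ℤ} {a : A} :
    w.get p = some a ↔ ∃ h : p ∈ Set.Icc w.lo w.hi, w.letter ⟨p, h⟩ = a := by
  unfold ZWord.get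
  split <;> simp_all

theorem ZWord.occursIn_transport {A B C : Type u} {d : ℕ} {f : A → B} {g : B → C}
    {w : ZWord A d} {x : (Fin d → ℤ) → Option C} :
    (w.transport le_rfl f).OccursIn g x ↔ w.OccursIn (g ∘ f) x := by
  refine exists_congr fun t => ⟨fun h p hp => ?_, fun h p hp => ?_⟩
  · exact h p (by simpa only [ZWord.transport, zeroExtend_self] using hp)
  · exact h p (by simpa only [ZWord.transport, zeroExtend_self] using hp)

theorem mem_language {A : Type u} {d : ℕ} {S : ZSubshift A d} {w : ZWord A d} :
    w ∈ language S ↔ ∃ x ∈ points S, ∀ p (hp : p ∈ Set.Icc w.lo w.hi),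
      x p = w.letter ⟨p, hp⟩ := by
  simp only [language, coLanguage, Set.mem_compl_iff, Set.mem_ofPred_eq, not_forall, not_not,
    exists_prop, funext_iff, Subtype.forall]
  rfl

/-- A pattern that occurs in a word of the language is in the language. -/
theorem transport_mem_language_of_occursIn {A A' B : Type u} {d e : ℕ} (hde : d ≤ e)
    {S : ZSubshift B e} {u : ZWord A d} {v : ZWord A' d} {h : A → B} {f : A' → A}
    (hu : u.transport hde h ∈ language S) (hv : v.OccursIn f u.get) :
    v.transport hde (h ∘ f) ∈ language S := by
  obtain ⟨x, hx, hxu⟩ := mem_language.1 hu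
  obtain ⟨t, ht⟩ := hv
  refine mem_language.2 ⟨fun q => x (zeroExtend t + q),
    @SymbolicDynamics.FullShift.Subshift.mapsTo B ⊥ (Fin e → ℤ) _ S (zeroExtend t) x hx,
    fun q hq => ?_⟩
  obtain ⟨h1, h2⟩ := ZWord.get_eq_some_iff.1 (ht _ (restrict_mem_Icc hde hq))
  have hq' : zeroExtend t + q = zeroExtend ((fun i => q (Fin.castLE hde i)) + t) := by
    rw [zeroExtend_add, zeroExtend_restrict hde hq, add_comm]
  have hm : zeroExtend t + q ∈ Set.Icc (zeroExtend u.lo) (zeroExtend u.hi) := by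
    rw [hq']
    exact ⟨zeroExtend_mono h1.1, zeroExtend_mono h1.2⟩
  refine (hxu _ hm).trans ?_
  simp only [ZWord.transport, Function.comp_apply, ← h2]
  congr 3
  funext i
  rw [hq', zeroExtend_castLE]

/-- The subshift generated by a set of points. -/
def subshiftClosure {A : Type u} {d : ℕ} (P : Set ((Fin d → ℤ) → A)) : ZSubshift A d :=
  letI : TopologicalSpace A := ⊥
  { carrier := {x | ∀ F : Finset (Fin d → ℤ), ∃ y ∈ P, ∃ t, ∀ p ∈ F, y (p + t) = x p}
    isClosed := by
      have : DiscreteTopology A := ⟨rfl⟩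
      rw [← isOpen_compl_iff, isOpen_iff_forall_mem_open]
      intro x hx
      simp only [Set.mem_compl_iff, Set.mem_ofPred_eq, not_forall] at hx
      obtain ⟨F, hF⟩ := hx
      refine ⟨(F : Set (Fin d → ℤ)).pi fun p => {x p}, fun z hz hz' => hF ?_,
        isOpen_set_pi F.finite_toSet fun _ _ => isOpen_discrete _, fun p _ => rfl⟩
      obtain ⟨y, hy, t, h⟩ := hz' F
      exact ⟨y, hy, t, fun p hp => (h p hp).trans (hz p hp)⟩
    mapsTo := by
      classical
      intro g x hx F
      obtain ⟨y, hy, t, h⟩ := hx (F.image fun p => g + p)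
      refine ⟨y, hy, g + t, fun p hp => ?_⟩
      have := h (g + p) (Finset.mem_image_of_mem _ hp)
      rw [show p + (g + t) = g + p + t by abel]
      exact this }

/-- Words have finite domains, so taking the closure of the shift orbits creates no new words. -/
theorem mem_language_subshiftClosure {A : Type u} {d : ℕ} {P : Set ((Fin d → ℤ) → A)}
    {w : ZWord A d} :
    w ∈ language (subshiftClosure P) ↔ ∃ y ∈ P, w.OccursIn id (some ∘ y) := by
  rw [mem_language]
  constructor
  · rintro ⟨x, hx, h⟩
    obtain ⟨y, hy, t, ht⟩ := hx (Set.finite_Icc w.lo w.hi).toFinset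
    refine ⟨y, hy, t, fun p hp => ?_⟩
    simp [ht p (by simpa using hp), h p hp]
  · rintro ⟨y, hy, t, ht⟩
    exact ⟨fun p => y (p + t), fun F => ⟨y, hy, t, fun _ _ => rfl⟩,
      fun p hp => Option.some_injective _ (ht p hp)⟩

theorem transport_mem_language_subshiftClosure {A B : Type u} {d : ℕ}
    {P : Set ((Fin d → ℤ) → B)} {w : ZWord A d} {f : A → B} :
    w.transport le_rfl f ∈ language (subshiftClosure P) ↔ ∃ y ∈ P, w.OccursIn f (some ∘ y) := by
  simp only [mem_language_subshiftClosure, ZWord.occursIn_transport, Function.id_comp]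

/-! ### Consistency of systems -/

/-- The positive information `P` and the negative information `N` about a subshift rule out that
the system `(U, V)` is consistent with it. -/
def Blocked {A : Type u} {d : ℕ} (P : Set ((Fin d → ℤ) → A)) (N : Set (ZWord A d))
    (U V : Set (ZWord (A ⊕ ℕ) d)) : Prop :=
  (∃ n ∈ N, ∃ u ∈ U, n.OccursIn Sum.inl u.get) ∨
  (∃ v ∈ V, ∃ x ∈ P, v.OccursIn id (some ∘ Sum.inl ∘ x)) ∨
  ∃ v ∈ V, ∃ u ∈ U, v.OccursIn id u.get

theorem Blocked.mono {A : Type u} {d : ℕ} {P P' : Set ((Fin d → ℤ) → A)} {N N' : Set (ZWord A d)}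
    {U V : Set (ZWord (A ⊕ ℕ) d)} (hP : P ⊆ P') (hN : N ⊆ N') (h : Blocked P N U V) :
    Blocked P' N' U V := by
  rcases h with ⟨n, hn, h⟩ | ⟨v, hv, x, hx, h⟩ | h
  · exact Or.inl ⟨n, hN hn, h⟩
  · exact Or.inr (Or.inl ⟨v, hv, x, hP hx, h⟩)
  · exact Or.inr (Or.inr h)

/-- The clashes are between formal symbols, so they survive every assignment of the variables. In
the first clause, a full restriction gains no words over the old alphabet; in the second, it loses
none. -/
theorem Blocked.not_isConsistentWith {A : Type u} {d : ℕ} {P : Set ((Fin d → ℤ) → A)}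
    {N : Set (ZWord A d)} {U V : Set (ZWord (A ⊕ ℕ) d)} (h : Blocked P N U V)
    (hPN : ∀ n ∈ N, ∀ x ∈ P, ¬ n.OccursIn id (some ∘ x)) :
    ¬ IsConsistentWith U V (subshiftClosure P) := by
  rintro ⟨B, ι, e, hde, S, hι, hS, b, hU, hV⟩
  rcases h with ⟨n, hn, u, hu, h⟩ | ⟨v, hv, x, hx, t, h⟩ | ⟨v, hv, u, hu, h⟩
  · have h1 : n.transport hde ι ∈ language S :=
      transport_mem_language_of_occursIn (h := Sum.elim ι b) hde (hU u hu) h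
    have h2 : n.transport hde ι ∈ ZWord.transport hde ι '' language (subshiftClosure P) :=
      hS ▸ ⟨h1, n, rfl⟩
    obtain ⟨w, hw, hwn⟩ := h2
    obtain rfl := ZWord.transport_injective hde hι hwn
    obtain ⟨y, hy, hwy⟩ := mem_language_subshiftClosure.1 hw
    exact hPN _ hn y hy hwy
  · let w : ZWord A d := ⟨v.lo, v.hi, v.le, fun p => x (p + t)⟩
    have h1 : w ∈ language (subshiftClosure P) :=
      mem_language_subshiftClosure.2 ⟨x, hx, t, fun p hp => rfl⟩
    have h2 : w.transport hde ι ∈ language S := (hS.symm ▸ Set.mem_image_of_mem _ h1 :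
      w.transport hde ι ∈ language S ∩ Set.range (ZWord.transport (A := A) hde ι)).1
    have h3 : v.transport hde (Sum.elim ι b) = w.transport hde ι := by
      simp only [ZWord.transport, w]
      congr 1
      funext q
      have := Option.some_injective _ (h _ (restrict_mem_Icc hde q.2))
      simp only [id_eq, Function.comp_apply] at this
      rw [← this, Sum.elim_inl]
    exact h2 (h3 ▸ hV v hv)
  · exact transport_mem_language_of_occursIn hde (hU u hu) h (hV v hv)

/-! ### Finite conditions -/

/-- The configuration takes the same value at all but finitely many positions. -/
def IsAlmostConstant {A : Type u} {d : ℕ} (x : (Fin d → ℤ) → A) : Prop :=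
  ∃ s, {p | x p ≠ s}.Finite

theorem IsAlmostConstant.finite_range {A : Type u} {d : ℕ} {x : (Fin d → ℤ) → A}
    (h : IsAlmostConstant x) : (Set.range x).Finite := by
  obtain ⟨s, hs⟩ := h
  refine ((hs.image x).insert s).subset ?_
  rintro _ ⟨p, rfl⟩
  by_cases hp : x p = s
  · exact Or.inl hp
  · exact Or.inr ⟨p, hp, rfl⟩

/-- The configuration that extends the word `u`, whose letters are replaced through `f`, by `s`. -/
noncomputable def ZWord.pad {A B : Type u} {d : ℕ} (f : A → B) (s : B) (u : ZWord A d)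
    (p : Fin d → ℤ) : B :=
  ((u.get p).map f).getD s

theorem ZWord.isAlmostConstant_pad {A B : Type u} {d : ℕ} (f : A → B) (s : B) (u : ZWord A d) :
    IsAlmostConstant (u.pad f s) := by
  refine ⟨s, (Set.finite_Icc u.lo u.hi).subset fun p hp => ?_⟩
  by_contra h
  exact hp (by simp [ZWord.pad, ZWord.get, dif_neg h])

theorem ZWord.occursIn_pad {A B : Type u} {d : ℕ} (f : A → B) (s : B) (u : ZWord A d) :
    u.OccursIn f (some ∘ u.pad f s) :=
  ⟨0, fun p hp => by simp [ZWord.pad, ZWord.get, dif_pos hp]⟩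

theorem ZWord.exists_get_of_pad {A B : Type u} {d : ℕ} {f : A → B} {s : B} {u : ZWord A d}
    {p : Fin d → ℤ} (h : u.pad f s p ≠ s) : ∃ l, u.get p = some l ∧ f l = u.pad f s p := by
  unfold ZWord.pad at h ⊢
  cases hu : u.get p with
  | none => simp [hu] at h
  | some l => exact ⟨l, rfl, by simp⟩

/-- Finite information about a subshift: a finite set `P` of points and a finite set `N` of words in
the co-language, each of which occurs in only finitely many of the reserved points `Y i`. -/
structure Cond {A : Type u} {d : ℕ} (Y : ℕ → (Fin d → ℤ) → A) where
  P : Set ((Fin d → ℤ) → A)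
  N : Set (ZWord A d)
  finite_P : P.Finite
  finite_N : N.Finite
  almostConstant : ∀ x ∈ P, IsAlmostConstant x
  not_occursIn : ∀ n ∈ N, ∀ x ∈ P, ¬ n.OccursIn id (some ∘ x)
  sparse : ∀ n ∈ N, {i | n.OccursIn id (some ∘ Y i)}.Finite

namespace Cond

variable {A : Type u} {d : ℕ} {Y : ℕ → (Fin d → ℤ) → A}

instance : Preorder (Cond Y) := Preorder.lift fun c => (c.P, c.N)

theorem le_def {c c' : Cond Y} : c ≤ c' ↔ c.P ⊆ c'.P ∧ c.N ⊆ c'.N := Iff.rfl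

instance : Nonempty (Cond Y) := ⟨⟨∅, ∅, by simp, by simp, by simp, by simp, by simp⟩⟩

/-- All but finitely many of the reserved points can be added to a condition. -/
theorem finite_not_addable (hY : ∀ i, IsAlmostConstant (Y i)) (c : Cond Y) :
    {i | ¬ ∃ c' ≥ c, Y i ∈ c'.P}.Finite := by
  refine (c.finite_N.biUnion c.sparse).subset fun i hi => ?_
  by_contra h
  simp only [Set.mem_iUnion, Set.mem_ofPred_eq, not_exists] at h
  refine hi ⟨⟨insert (Y i) c.P, c.N, c.finite_P.insert _, c.finite_N, ?_, ?_, c.sparse⟩,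
    le_def.2 ⟨Set.subset_insert _ _, le_rfl⟩, Set.mem_insert _ _⟩
  · rintro x (rfl | hx)
    · exact hY i
    · exact c.almostConstant x hx
  · rintro n hn x (rfl | hx)
    · exact h n hn
    · exact c.not_occursIn n hn x hx

/-- The condition forces the system `(U, V)` to be satisfied. -/
def Realizes (c : Cond Y) (U V : Set (ZWord (A ⊕ ℕ) d)) : Prop :=
  ∃ b : ℕ → A, (∀ u ∈ U, ∃ x ∈ c.P, u.OccursIn (Sum.elim id b) (some ∘ x)) ∧
    ∀ v ∈ V, v.transport le_rfl (Sum.elim id b) ∈ c.N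

/-- Finitely many letters suffice for a condition, the reserved points and the constants of a finite
system. -/
theorem exists_finite_letters (hY : (⋃ i, Set.range (Y i)).Finite) (c : Cond Y)
    {U V : Set (ZWord (A ⊕ ℕ) d)} (hU : U.Finite) (hV : V.Finite) :
    ∃ F : Set A, F.Finite ∧ (∀ i p, Y i p ∈ F) ∧ (∀ x ∈ c.P, ∀ p, x p ∈ F) ∧
      (∀ n ∈ c.N, ∀ p, n.letter p ∈ F) ∧
      ∀ w ∈ U ∪ V, ∀ p a, w.letter p = Sum.inl a → a ∈ F := by
  have hfin (lo hi : Fin d → ℤ) : Finite (Set.Icc lo hi) := (Set.finite_Icc lo hi).to_subtype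
  refine ⟨(⋃ i, Set.range (Y i)) ∪ (⋃ x ∈ c.P, Set.range x) ∪ (⋃ n ∈ c.N, Set.range n.letter) ∪
    ⋃ w ∈ U ∪ V, Sum.inl ⁻¹' Set.range w.letter, ?_, ?_, ?_, ?_, ?_⟩
  · refine ((hY.union ?_).union ?_).union ?_
    · exact c.finite_P.biUnion fun x hx => (c.almostConstant x hx).finite_range
    · exact c.finite_N.biUnion fun n _ => Set.finite_range _
    · exact (hU.union hV).biUnion fun w _ =>
        (Set.finite_range _).preimage Sum.inl_injective.injOn
  · exact fun i p => Or.inl (Or.inl (Or.inl (Set.mem_iUnion.2 ⟨i, p, rfl⟩)))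
  · exact fun x hx p => Or.inl (Or.inl (Or.inr (Set.mem_biUnion hx ⟨p, rfl⟩)))
  · exact fun n hn p => Or.inl (Or.inr (Set.mem_biUnion hn ⟨p, rfl⟩))
  · exact fun w hw p a h => Or.inr (Set.mem_biUnion hw ⟨p, h⟩)

/-- Every condition can be extended so that it decides a given finite system. -/
theorem exists_decides [Infinite A] (hY : ∀ i, IsAlmostConstant (Y i))
    (hY' : (⋃ i, Set.range (Y i)).Finite) {U V : Set (ZWord (A ⊕ ℕ) d)} (hU : U.Finite)
    (hV : V.Finite) (c : Cond Y) : ∃ c' ≥ c, Blocked c'.P c'.N U V ∨ c'.Realizes U V := by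
  by_cases hB : Blocked c.P c.N U V
  · exact ⟨c, le_rfl, Or.inl hB⟩
  -- Such a `v` occurs in some reserved point that can still be added, which blocks the system.
  -- Without such a `v`, forbidding `V` will respect `sparse`.
  by_cases hI : ∃ v ∈ V, {i | v.OccursIn id (some ∘ Sum.inl ∘ Y i)}.Infinite
  · obtain ⟨v, hv, hI⟩ := hI
    obtain ⟨i, hi, hi'⟩ := (hI.sdiff (finite_not_addable hY c)).nonempty
    obtain ⟨c', hc', hc'i⟩ := not_not.1 hi'
    exact ⟨c', hc', Or.inl (Or.inr (Or.inl ⟨v, hv, _, hc'i, hi⟩))⟩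
  obtain ⟨F, hF, hFY, hFP, hFN, hFUV⟩ := exists_finite_letters hY' c hU hV
  have : Infinite ↥Fᶜ := hF.infinite_compl.to_subtype
  -- Fresh letters: `g 0` is the padding and `g (n + 1)` interprets the variable `n`, so letters
  -- coincide under `k` only if they are formally equal.
  let g : ℕ ↪ ↥Fᶜ := Infinite.natEmbedding _
  let s : A := g 0
  let b : ℕ → A := fun n => g (n + 1)
  let k : A ⊕ ℕ → A := Sum.elim id b
  have hkF : ∀ l, k l ∈ F → l = Sum.inl (k l) := by
    rintro (a | n) h
    · rfl
    · exact absurd h (g (n + 1)).2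
  have hks : ∀ w ∈ U ∪ V, ∀ p, k (w.letter p) ≠ s := by
    intro w hw p h
    cases hl : w.letter p with
    | inl a =>
      have ha : a = s := by simpa [k, hl] using h
      exact (g 0).2 (show s ∈ F from ha ▸ hFUV w hw p a hl)
    | inr n =>
      have := g.injective (Subtype.ext (by simpa [k, hl, b, s] using h) : g (n + 1) = g 0)
      exact Nat.succ_ne_zero n this
  have hkk : ∀ w ∈ U ∪ V, ∀ w' ∈ U ∪ V, ∀ p p', k (w.letter p) = k (w'.letter p') →
      w.letter p = w'.letter p' := by
    intro w hw w' hw' p p' h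
    cases hl : w.letter p with
    | inl a =>
      have ha := hFUV w hw p a hl
      rw [hl] at h
      have h' : k (w'.letter p') = a := h.symm
      rw [hkF (w'.letter p') (h' ▸ ha), h']
    | inr n =>
      cases hl' : w'.letter p' with
      | inl a =>
        have ha := hFUV w' hw' p' a hl'
        rw [hl, hl'] at h
        have h' : (g (n + 1) : A) = a := h
        exact absurd (h' ▸ ha) (g (n + 1)).2
      | inr m =>
        rw [hl, hl'] at h
        have := g.injective (Subtype.ext h : g (n + 1) = g (m + 1))
        rw [Nat.succ.inj this]
  have hvx : ∀ v ∈ V, ∀ x : (Fin d → ℤ) → A, (∀ p, x p ∈ F) →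
      v.OccursIn k (some ∘ x) → v.OccursIn id (some ∘ Sum.inl ∘ x) := by
    rintro v - x hx ⟨t, ht⟩
    refine ⟨t, fun p hp => ?_⟩
    have h : x (p + t) = k (v.letter ⟨p, hp⟩) := Option.some_injective _ (ht p hp)
    have := hkF _ (h ▸ hx (p + t))
    simp only [Function.comp_apply, id_eq, h, ← this]
  refine ⟨⟨c.P ∪ (fun u => u.pad k s) '' U, c.N ∪ (fun v => v.transport le_rfl k) '' V,
    c.finite_P.union (hU.image _), c.finite_N.union (hV.image _), ?_, ?_, ?_⟩,
    le_def.2 ⟨Set.subset_union_left, Set.subset_union_left⟩, Or.inr ⟨b, ?_, ?_⟩⟩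
  · rintro x (hx | ⟨u, -, rfl⟩)
    · exact c.almostConstant x hx
    · exact u.isAlmostConstant_pad k s
  -- Freshness pulls each occurrence that involves a new point or a new word back to a formal one,
  -- that is, to one of the three clauses of `Blocked`.
  · rintro n (hn | ⟨v, hv, rfl⟩) x (hx | ⟨u, hu, rfl⟩) hocc
    · exact c.not_occursIn n hn x hx hocc
    · refine hB (Or.inl ⟨n, hn, u, hu, ?_⟩)
      obtain ⟨t, ht⟩ := hocc
      refine ⟨t, fun p hp => ?_⟩
      have h : u.pad k s (p + t) = n.letter ⟨p, hp⟩ := Option.some_injective _ (ht p hp)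
      have hmem := hFN n hn ⟨p, hp⟩
      obtain ⟨l, hl, hkl⟩ := ZWord.exists_get_of_pad (f := k) (s := s) (u := u) (p := p + t)
        fun h' => (g 0).2 (show s ∈ F from h' ▸ h ▸ hmem)
      rw [h] at hkl
      rw [hl, hkF l (hkl ▸ hmem), hkl]
    · rw [ZWord.occursIn_transport] at hocc
      exact hB (Or.inr (Or.inl ⟨v, hv, x, hx, hvx v hv x (hFP x hx) hocc⟩))
    · rw [ZWord.occursIn_transport] at hocc
      refine hB (Or.inr (Or.inr ⟨v, hv, u, hu, ?_⟩))
      obtain ⟨t, ht⟩ := hocc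
      refine ⟨t, fun p hp => ?_⟩
      have h : u.pad k s (p + t) = k (v.letter ⟨p, hp⟩) := Option.some_injective _ (ht p hp)
      obtain ⟨l, hl, hkl⟩ := ZWord.exists_get_of_pad (f := k) (s := s) (u := u) (p := p + t)
        (h ▸ hks v (Or.inr hv) _)
      obtain ⟨hq, rfl⟩ := ZWord.get_eq_some_iff.1 hl
      rw [hl, hkk u (Or.inl hu) v (Or.inr hv) _ _ (hkl.trans h), id]
  · rintro n (hn | ⟨v, hv, rfl⟩)
    · exact c.sparse n hn
    · refine (Set.not_infinite.1 fun h => hI ⟨v, hv, h⟩).subset fun i hi => ?_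
      exact hvx v hv (Y i) (hFY i) (ZWord.occursIn_transport.1 hi)
  · exact fun u hu => ⟨_, Or.inr ⟨u, hu, rfl⟩, u.occursIn_pad k s⟩
  · exact fun v hv => Or.inr ⟨v, hv, rfl⟩

end Cond

/-! ### Spikes -/

section Spikes

variable {A : Type u} {d : ℕ} (o : Fin d)

/-- The configuration with value `a` at the positions `0` and `(i + 1) e_o` and `b` elsewhere. -/
noncomputable def spikes (a b : A) (i : ℕ) (p : Fin d → ℤ) : A :=
  open Classical in if p = 0 ∨ p = Pi.single o (i + 1 : ℤ) then a else b

/-- The word `a b ⋯ b a`, with `i` letters `b`, in the direction `o`. -/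
noncomputable def spikeWord (a b : A) (i : ℕ) : ZWord A d where
  lo := 0
  hi := Pi.single o (i + 1 : ℤ)
  le := Pi.single_nonneg.2 (by positivity)
  letter p := spikes o a b i p

theorem spikes_mem (a b : A) (i : ℕ) (p : Fin d → ℤ) : spikes o a b i p ∈ ({a, b} : Set A) := by
  unfold spikes
  split <;> simp

theorem isAlmostConstant_spikes (a b : A) (i : ℕ) : IsAlmostConstant (spikes o a b i) := by
  refine ⟨b, (Set.toFinite {0, Pi.single o (i + 1 : ℤ)}).subset fun p hp => ?_⟩
  by_contra h
  exact hp (if_neg h)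

theorem coord_of_spikes_ne {a b : A} {i : ℕ} {p : Fin d → ℤ} (h : spikes o a b i p ≠ b) :
    p o = 0 ∨ p o = i + 1 := by
  by_contra hp
  refine h (if_neg fun h' => hp ?_)
  rcases h' with rfl | rfl <;> simp

theorem occursIn_spikes (a b : A) (i : ℕ) :
    (spikeWord o a b i).OccursIn id (some ∘ spikes o a b i) :=
  ⟨0, fun p _ => by simp [spikeWord]⟩

theorem occursIn_spikeWord_map {B : Type u} (f : A → B) (a b : A) (i : ℕ)
    {x : (Fin d → ℤ) → Option B} :
    (spikeWord o a b i).OccursIn f x ↔ (spikeWord o (f a) (f b) i).OccursIn id x := by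
  refine exists_congr fun t => forall_congr' fun p => forall_congr' fun hp => ?_
  simp only [spikeWord, spikes, id_eq, apply_ite f]

theorem exists_of_occursIn_spikeWord {a b : A} {i : ℕ} {x : (Fin d → ℤ) → A}
    (h : (spikeWord o a b i).OccursIn id (some ∘ x)) :
    ∃ t : Fin d → ℤ, x t = a ∧ x (Pi.single o (i + 1 : ℤ) + t) = a ∧
      ∀ j : ℕ, 0 < j → j < i + 1 → x (Pi.single o (j : ℤ) + t) = b := by
  obtain ⟨t, ht⟩ := h
  have key : ∀ j : ℕ, j ≤ i + 1 →
      x (Pi.single o (j : ℤ) + t) = spikes o a b i (Pi.single o (j : ℤ)) := fun j hj =>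
    Option.some_injective _ (ht _ ⟨Pi.single_nonneg.2 (by positivity),
      Pi.single_mono o (show (j : ℤ) ≤ i + 1 by exact_mod_cast hj)⟩)
  refine ⟨t, ?_, ?_, fun j h0 hj => ?_⟩
  · simpa [spikes] using key 0 (Nat.zero_le _)
  · simpa [spikes] using key (i + 1) le_rfl
  · rw [key j hj.le]
    by_contra hb
    have := coord_of_spikes_ne o hb
    simp only [Pi.single_eq_same] at this
    omega

/-- At most one of `a`, `b` is the background letter of `x`, so two far apart positions of a long
spike word (the ends, or the first and last `b`) would both be exceptional, and these positions have
bounded distance. -/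
theorem finite_occursIn_spikeWord {a b : A} (hab : a ≠ b) {x : (Fin d → ℤ) → A}
    (hx : IsAlmostConstant x) : {i | (spikeWord o a b i).OccursIn id (some ∘ x)}.Finite := by
  obtain ⟨s, hs⟩ := hx
  have hfin := (hs.prod hs).image fun q => (q.1 o - q.2 o).natAbs
  obtain ⟨m, hm⟩ := hfin.bddAbove
  refine (Set.finite_Iic (m + 1)).subset fun i hi => ?_
  obtain ⟨t, h0, h1, h2⟩ := exists_of_occursIn_spikeWord o hi
  have hle : ∀ p q : Fin d → ℤ, x p ≠ s → x q ≠ s → (p o - q o).natAbs ≤ m := fun p q hp hq =>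
    hm ⟨(p, q), ⟨hp, hq⟩, rfl⟩
  rw [Set.mem_Iic]
  by_cases ha : a = s
  · by_contra hi'
    have := hle _ _ ((h2 1 one_pos (by omega)).trans_ne (ha ▸ hab.symm))
      ((h2 i (by omega) (by omega)).trans_ne (ha ▸ hab.symm))
    simp only [Pi.add_apply, Pi.single_eq_same] at this
    omega
  · have := hle _ _ (h0.trans_ne ha) (h1.trans_ne ha)
    simp only [Pi.add_apply, Pi.single_eq_same] at this
    omega

/-- If `a' ≠ b`, the two ends fall on the two spikes, which forces `i = j`. If `a' = b`, two
adjacent letters `b'`, available as `2 ≤ i`, fall on the spikes, which forces `j = 0`. -/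
theorem eq_of_occursIn_spikes {a b a' b' : A} (hab' : a' ≠ b') {i j : ℕ} (hi : 2 ≤ i)
    (h : (spikeWord o a' b' i).OccursIn id (some ∘ spikes o a b j)) : i = j ∨ j = 0 := by
  obtain ⟨t, h0, h1, h2⟩ := exists_of_occursIn_spikeWord o h
  have h3 := h2 1 one_pos (by omega)
  have h4 := h2 2 two_pos (by omega)
  by_cases hb : a' = b
  · have hb' : b' ≠ b := fun h => hab' (hb.trans h.symm)
    have h5 := coord_of_spikes_ne o (h3.trans_ne hb')
    have h6 := coord_of_spikes_ne o (h4.trans_ne hb')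
    simp only [Pi.add_apply, Pi.single_eq_same] at h5 h6
    omega
  · have h5 := coord_of_spikes_ne o (h0.trans_ne hb)
    have h6 := coord_of_spikes_ne o (h1.trans_ne hb)
    simp only [Pi.add_apply, Pi.single_eq_same] at h5 h6
    omega

/-- Two conditions can be extended so that no embedding of a subshift as in the first one into a
subshift as in the second one maps `a` to `a'` and `b` to `b'`. -/
theorem Cond.exists_separates {a b a' b' : A} (hab' : a' ≠ b') (c e : Cond (spikes o a b)) :
    ∃ c' ≥ c, ∃ e' ≥ e, ∃ i, spikes o a b i ∈ c'.P ∧ spikeWord o a' b' i ∈ e'.N := by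
  -- The finitely many bad `i`: the point cannot be added to `c`, the word already occurs in a point
  -- of `e`, or `i` is too small for `eq_of_occursIn_spikes`.
  have hfin := ((Cond.finite_not_addable (isAlmostConstant_spikes o a b) c).union
    (e.finite_P.biUnion fun x hx => finite_occursIn_spikeWord o hab' (e.almostConstant x hx))).union
    (Set.finite_Iio 2)
  obtain ⟨i, hi⟩ := hfin.infinite_compl.nonempty
  simp only [Set.mem_compl_iff, Set.mem_union, Set.mem_ofPred_eq, not_or, Set.mem_iUnion, exists_prop,
    Set.mem_Iio, not_lt] at hi
  obtain ⟨⟨hc, hP⟩, hi2⟩ := hi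
  obtain ⟨c', hc', hc'i⟩ := not_not.1 hc
  refine ⟨c', hc', ⟨e.P, insert (spikeWord o a' b' i) e.N, e.finite_P, e.finite_N.insert _,
    e.almostConstant, ?_, ?_⟩, Cond.le_def.2 ⟨le_rfl, Set.subset_insert _ _⟩, i, hc'i,
    Set.mem_insert _ _⟩
  · rintro n (rfl | hn) x hx
    · exact fun h => hP ⟨x, hx, h⟩
    · exact e.not_occursIn n hn x hx
  · rintro n (rfl | hn)
    · refine (Set.toFinite {i, 0}).subset fun j hj => ?_
      exact (eq_of_occursIn_spikes o hab' hi2 hj).imp Eq.symm id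
    · exact e.sparse n hn

end Spikes

/-- The union of a chain of conditions that decides every finite system is an ecfcs subshift. -/
theorem isEcfcs_of_decides {A : Type u} {d : ℕ} {Y : ℕ → (Fin d → ℤ) → A} {s : ℕ → Cond Y}
    (hs : Monotone s) (h : ∀ U V : Set (ZWord (A ⊕ ℕ) d), U.Finite → V.Finite →
      ∃ n, Blocked (s n).P (s n).N U V ∨ (s n).Realizes U V) :
    (∀ w ∈ ⋃ n, (s n).N, ∀ x ∈ ⋃ n, (s n).P, ¬ w.OccursIn id (some ∘ x)) ∧
      IsEcfcs (subshiftClosure (⋃ n, (s n).P)) := by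
  have hPN : ∀ w ∈ ⋃ n, (s n).N, ∀ x ∈ ⋃ n, (s n).P, ¬ w.OccursIn id (some ∘ x) := by
    intro w hw x hx
    obtain ⟨n, hn⟩ := Set.mem_iUnion.1 hw
    obtain ⟨m, hm⟩ := Set.mem_iUnion.1 hx
    exact (s (max n m)).not_occursIn w ((hs (le_max_left n m)).2 hn) x
      ((hs (le_max_right n m)).1 hm)
  refine ⟨hPN, fun U V hU hV hcons => ?_⟩
  obtain ⟨n, hn | ⟨b, hbU, hbV⟩⟩ := h U V hU hV
  · have hB := hn.mono (Set.subset_iUnion (fun n => (s n).P) n)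
      (Set.subset_iUnion (fun n => (s n).N) n)
    exact absurd hcons (hB.not_isConsistentWith hPN)
  · refine ⟨b, fun u hu => ?_, fun v hv => ?_⟩
    · obtain ⟨x, hx, hux⟩ := hbU u hu
      exact transport_mem_language_subshiftClosure.2 ⟨x, Set.mem_iUnion.2 ⟨n, hx⟩, hux⟩
    · by_contra hv'
      obtain ⟨y, hy, hvy⟩ := mem_language_subshiftClosure.1
        (show _ ∈ language (subshiftClosure (⋃ n, (s n).P)) from hv')
      exact hPN _ (Set.mem_iUnion.2 ⟨n, hbV v hv⟩) y hy hvy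

theorem mainTheorem5 (d : ℕ) (hd : 1 ≤ d) (A : Type u) [Countable A] [Infinite A] :
    ∃ M : (ℕ → Bool) → ZSubshift A d,
      (∀ α, IsEcfcs (M α)) ∧ ∀ α β, α ≠ β → ¬ Embeds (M α) (M β) := by
  obtain ⟨a, b, hab⟩ := exists_pair_ne A
  let o : Fin d := ⟨0, hd⟩
  let Y := spikes o a b
  have hY' : (⋃ i, Set.range (Y i)).Finite := by
    refine (Set.toFinite {a, b}).subset (Set.iUnion_subset fun i => ?_)
    rintro _ ⟨p, rfl⟩
    exact spikes_mem o a b i p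
  obtain ⟨sys, hsys⟩ := exists_surjective_nat
    (Finset (ZWord (A ⊕ ℕ) d) × Finset (ZWord (A ⊕ ℕ) d))
  -- Enumerates the possible values of `(f a, f b)` for an embedding `f`.
  obtain ⟨img, himg⟩ := exists_surjective_nat (A × A)
  obtain ⟨s, hmono, hD, hE⟩ := exists_mutually_generic (C := Cond Y)
    (fun k => {c | Blocked c.P c.N (sys k).1 (sys k).2 ∨ c.Realizes (sys k).1 (sys k).2})
    (fun k => {q | (img k).1 ≠ (img k).2 →
      ∃ i, Y i ∈ q.1.P ∧ spikeWord o (img k).1 (img k).2 i ∈ q.2.N})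
    (fun k c => c.exists_decides (isAlmostConstant_spikes o a b) hY' (Finset.finite_toSet _)
      (Finset.finite_toSet _))
    (fun k c e => by
      by_cases h : (img k).1 = (img k).2
      · exact ⟨c, le_rfl, e, le_rfl, fun h' => absurd h h'⟩
      · obtain ⟨c', hc', e', he', hi⟩ := Cond.exists_separates o h c e
        exact ⟨c', hc', e', he', fun _ => hi⟩)
    (fun k q q' hle hq hne => by
      obtain ⟨i, h1, h2⟩ := hq hne
      exact ⟨i, hle.1.1 h1, hle.2.2 h2⟩)
  have hM α := isEcfcs_of_decides (hmono α) fun U V hU hV => by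
    obtain ⟨k, hk⟩ := hsys (hU.toFinset, hV.toFinset)
    obtain ⟨n, hn⟩ := hD α k
    refine ⟨n, ?_⟩
    simpa only [Set.mem_ofPred_eq, hk, Set.Finite.coe_toFinset] using hn
  refine ⟨fun α => subshiftClosure (⋃ n, (s α n).P), fun α => (hM α).2, ?_⟩
  rintro α β hαβ ⟨hde, f, hf, hfull⟩
  obtain ⟨k, hk⟩ := himg (f a, f b)
  obtain ⟨n, hn⟩ := hE α β hαβ k
  simp only [Set.mem_ofPred_eq, hk] at hn
  obtain ⟨i, h1, h2⟩ := hn (hf.ne hab)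
  have hw : spikeWord o a b i ∈ language (subshiftClosure (⋃ n, (s α n).P)) :=
    mem_language_subshiftClosure.2 ⟨_, Set.mem_iUnion.2 ⟨n, h1⟩, occursIn_spikes o a b i⟩
  have hw' := (hfull.symm ▸ Set.mem_image_of_mem (ZWord.transport hde f) hw :
    (spikeWord o a b i).transport hde f ∈ language (subshiftClosure (⋃ n, (s β n).P)) ∩
      Set.range (ZWord.transport (A := A) hde f)).1
  obtain ⟨y, hy, hyw⟩ := transport_mem_language_subshiftClosure.1 hw'
  exact (hM β).1 _ (Set.mem_iUnion.2 ⟨n, h2⟩) y hy ((occursIn_spikeWord_map o f a b i).1 hyw)
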